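/- Let an $r$-graph be a finite $r$-uniform hypergraph, that is, a finite vertex set $V$ together with a set $H$ of $r$-element subsets of $V$ (its edges), and let its Lagrangian be $$\lambda(H)=\max\Big\{\sum_{A\in H}\prod_{i\in A}y_i \;:\; y\in\mathbb{R}^V,\ y_i\ge 0 \text{ for all } i\in V,\ \sum_{i\in V}y_i=1\Big\}.$$ For every integer $r\ge 4$ there exists $t_r\in\mathbb{N}$ such that for all integers $t\ge t_r$ the following holds: if $m$ is an integer with $\binom{t-1}{r}<m\le\binom{t}{r}$ and $H$ is an $r$-graph with exactly $m$ edges, then $$\lambda(H)\le\frac{1}{t^r}\binom{t}{r}.$$ -/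

import Mathlib

/-- The multilinear polynomial `L(H, y) = ∑_{A ∈ H} ∏_{i ∈ A} y_i` of a finite hypergraph on the
vertex set `V`, given by its finite set `H` of edges. -/
def hypergraphPoly {V : Type*} (H : Finset (Finset V)) (y : V → ℝ) : ℝ :=
  ∑ A ∈ H, ∏ i ∈ A, y i

/-- The Lagrangian `λ(H)`: the maximum of `L(H, ·)` over the standard simplex, that is over all
`y : V → ℝ` with `y i ≥ 0` for all `i` and `∑ i, y i = 1`. It is written as a supremum; that it is
a maximum is shown in `isGreatest_lagrangian`. -/
noncomputable def lagrangian {V : Type*} [Fintype V] (H : Finset (Finset V)) : ℝ :=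
  sSup (hypergraphPoly H '' stdSimplex ℝ V)

/-- For a nonempty vertex set the Lagrangian is attained. -/
theorem isGreatest_lagrangian {V : Type*} [Fintype V] [Nonempty V] (H : Finset (Finset V)) :
    IsGreatest (hypergraphPoly H '' stdSimplex ℝ V) (lagrangian H) := by
  classical
  have hc : Continuous (hypergraphPoly H) := by
    unfold hypergraphPoly
    fun_prop
  have hne : (stdSimplex ℝ V).Nonempty :=
    ⟨Pi.single (Classical.arbitrary V) 1, single_mem_stdSimplex ℝ _⟩
  exact ((isCompact_stdSimplex ℝ V).image hc).isGreatest_sSup (hne.image _)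

/-! Let `y` be a maximum point, `P` the maximum and `m` the number of edges. Stationarity says that
an edge drawn with probability proportional to its monomial contains vertex `i` with probability `r
* y i`. The entropy of this random edge is at most `log m`, which gives `P ≤ m * exp (-r * h)`,
where `h` is the entropy of `y` (`log_div_card_le_of_isMax`). If `h ≥ log t`, then `P ≤ m / t ^ r`
and the bound on `m` finishes.

If `h ≤ log t`, the edge set is forgotten: `P` is at most the full elementary symmetric polynomial,
and `elemSymm_le_choose_div_pow` compares that with the uniform distribution on `t` points. A large
sum of squares gives this directly. Otherwise all weights are small, and the recursion
`succ_succ_mul_elemSymm` loses at least as much at each degree as in the uniform case, by the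
entropy inequality `sum_mul_deletedSymm_le`. -/

/-- The elementary symmetric polynomial of degree `j` in the variables `x i`, `i ∈ s`. -/
noncomputable def elemSymm {ι : Type*} (x : ι → ℝ) (s : Finset ι) (j : ℕ) : ℝ :=
  ∑ A ∈ s.powersetCard j, ∏ i ∈ A, x i

/-- The polynomial in `z` whose value at `z = x i` is the elementary symmetric polynomial of
degree `j` in all variables but `x i`. -/
noncomputable def deletedSymm {ι : Type*} [Fintype ι] (x : ι → ℝ) : ℕ → ℝ → ℝ
  | 0, _ => 1
  | j + 1, z => elemSymm x Finset.univ (j + 1) - z * deletedSymm x j z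

/-! ### Elementary symmetric polynomials of a probability vector -/

section ElemSymm

variable {ι : Type*}

theorem elemSymm_zero (x : ι → ℝ) (s : Finset ι) : elemSymm x s 0 = 1 := by
  simp [elemSymm]

theorem elemSymm_nonneg {x : ι → ℝ} (hx : ∀ i, 0 ≤ x i) (s : Finset ι) (j : ℕ) :
    0 ≤ elemSymm x s j :=
  Finset.sum_nonneg fun _ _ => Finset.prod_nonneg fun i _ => hx i

theorem elemSymm_mono {x : ι → ℝ} (hx : ∀ i, 0 ≤ x i) {s u : Finset ι} (h : s ⊆ u) (j : ℕ) :
    elemSymm x s j ≤ elemSymm x u j :=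
  Finset.sum_le_sum_of_subset_of_nonneg (Finset.powersetCard_mono h)
    fun _ _ _ => Finset.prod_nonneg fun i _ => hx i

theorem elemSymm_insert [DecidableEq ι] (x : ι → ℝ) {s : Finset ι} {i : ι} (hi : i ∉ s) (j : ℕ) :
    elemSymm x (insert i s) (j + 1) = elemSymm x s (j + 1) + x i * elemSymm x s j := by
  unfold elemSymm
  have hmem : ∀ A ∈ s.powersetCard j, i ∉ A := fun A hA hiA =>
    hi ((Finset.mem_powersetCard.1 hA).1 hiA)
  rw [Finset.powersetCard_succ_insert hi, Finset.sum_union, Finset.sum_image, Finset.mul_sum]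
  · congr 1
    exact Finset.sum_congr rfl fun A hA => Finset.prod_insert (hmem A hA)
  · intro A hA B hB hAB
    rw [← Finset.erase_insert (hmem A hA), ← Finset.erase_insert (hmem B hB)]
    exact congrArg (fun C => C.erase i) hAB
  · rw [Finset.disjoint_left]
    rintro A hA hA'
    obtain ⟨B, -, rfl⟩ := Finset.mem_image.1 hA'
    exact hi ((Finset.mem_powersetCard.1 hA).1 (Finset.mem_insert_self i B))

variable [Fintype ι]

theorem elemSymm_univ_succ [DecidableEq ι] (x : ι → ℝ) (i : ι) (j : ℕ) :
    elemSymm x Finset.univ (j + 1) = elemSymm x (Finset.univ.erase i) (j + 1) +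
      x i * elemSymm x (Finset.univ.erase i) j := by
  rw [← elemSymm_insert x (Finset.notMem_erase i _), Finset.insert_erase (Finset.mem_univ i)]

theorem deletedSymm_apply [DecidableEq ι] (x : ι → ℝ) (i : ι) (j : ℕ) :
    deletedSymm x j (x i) = elemSymm x (Finset.univ.erase i) j := by
  induction j with
  | zero => simp [deletedSymm, elemSymm_zero]
  | succ j ih =>
    rw [deletedSymm, ih, elemSymm_univ_succ x i j]
    ring

theorem sum_sum_filter_mem {V : Type*} [Fintype V] [DecidableEq V] {H : Finset (Finset V)} {r : ℕ}
    (hH : ∀ A ∈ H, A.card = r) (f : Finset V → ℝ) :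
    ∑ i, ∑ A ∈ H with i ∈ A, f A = r * ∑ A ∈ H, f A := by
  simp_rw [Finset.sum_filter]
  rw [Finset.sum_comm, Finset.mul_sum]
  refine Finset.sum_congr rfl fun A hA => ?_
  rw [← Finset.sum_filter, Finset.sum_const, Finset.filter_mem_eq_inter, Finset.univ_inter, hH A hA,
    nsmul_eq_mul]

theorem sum_mul_deletedSymm (x : ι → ℝ) (j : ℕ) :
    ∑ i, x i * deletedSymm x j (x i) = (j + 1) * elemSymm x Finset.univ (j + 1) := by
  classical
  have h := sum_sum_filter_mem (H := (Finset.univ : Finset ι).powersetCard (j + 1)) (r := j + 1)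
    (fun A hA => (Finset.mem_powersetCard.1 hA).2) (fun A => ∏ i ∈ A, x i)
  push_cast at h
  rw [elemSymm, ← h]
  refine Finset.sum_congr rfl fun i _ => ?_
  have h1 := elemSymm_univ_succ x i j
  have h2 := Finset.sum_filter_add_sum_filter_not
    ((Finset.univ : Finset ι).powersetCard (j + 1)) (fun A => i ∈ A) (fun A => ∏ i ∈ A, x i)
  have h3 : ((Finset.univ : Finset ι).powersetCard (j + 1)).filter (fun A => i ∉ A) =
      (Finset.univ.erase i).powersetCard (j + 1) := by
    ext A
    simp only [Finset.mem_filter, Finset.mem_powersetCard, Finset.subset_erase]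
    tauto
  rw [h3] at h2
  rw [deletedSymm_apply]
  simp only [elemSymm] at h1 ⊢
  linarith

theorem succ_succ_mul_elemSymm {x : ι → ℝ} (hx1 : ∑ i, x i = 1) (j : ℕ) :
    ((j : ℝ) + 2) * elemSymm x Finset.univ (j + 2) =
      elemSymm x Finset.univ (j + 1) - ∑ i, x i ^ 2 * deletedSymm x j (x i) := by
  have h := sum_mul_deletedSymm x (j + 1)
  simp only [deletedSymm, mul_sub, Finset.sum_sub_distrib, ← Finset.sum_mul, hx1] at h
  push_cast at h
  rw [show (j : ℝ) + 2 = j + 1 + 1 by ring, ← h, one_mul]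
  congr 1
  exact Finset.sum_congr rfl fun i _ => by ring

theorem deletedSymm_apply_nonneg {x : ι → ℝ} (hx : ∀ i, 0 ≤ x i) (j : ℕ) (i : ι) :
    0 ≤ deletedSymm x j (x i) := by
  classical
  rw [deletedSymm_apply]
  exact elemSymm_nonneg hx _ _

theorem succ_mul_elemSymm_le {x : ι → ℝ} (hx : ∀ i, 0 ≤ x i) (hx1 : ∑ i, x i = 1) (j : ℕ) :
    ((j : ℝ) + 1) * elemSymm x Finset.univ (j + 1) ≤ elemSymm x Finset.univ j := by
  classical
  rw [← sum_mul_deletedSymm]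
  calc ∑ i, x i * deletedSymm x j (x i) ≤ ∑ i, x i * elemSymm x Finset.univ j := by
        refine Finset.sum_le_sum fun i _ => mul_le_mul_of_nonneg_left ?_ (hx i)
        rw [deletedSymm_apply]
        exact elemSymm_mono hx (Finset.erase_subset _ _) j
    _ = elemSymm x Finset.univ j := by rw [← Finset.sum_mul, hx1, one_mul]

theorem elemSymm_le_one {x : ι → ℝ} (hx : ∀ i, 0 ≤ x i) (hx1 : ∑ i, x i = 1) (j : ℕ) :
    elemSymm x Finset.univ j ≤ 1 := by
  induction j with
  | zero => rw [elemSymm_zero]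
  | succ j ih =>
    have h := succ_mul_elemSymm_le hx hx1 j
    have h0 := mul_nonneg (Nat.cast_nonneg (α := ℝ) j) (elemSymm_nonneg hx Finset.univ (j + 1))
    linarith

theorem factorial_mul_elemSymm_le {x : ι → ℝ} (hx : ∀ i, 0 ≤ x i) (hx1 : ∑ i, x i = 1) (j : ℕ) :
    ((j + 2).factorial : ℝ) * elemSymm x Finset.univ (j + 2) ≤ 1 - ∑ i, x i ^ 2 := by
  induction j with
  | zero =>
    have h := succ_succ_mul_elemSymm hx1 0
    have h1 := succ_mul_elemSymm_le hx hx1 0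
    simp [deletedSymm, elemSymm_zero] at h h1 ⊢
    linarith
  | succ j ih =>
    refine le_trans ?_ ih
    have h := succ_mul_elemSymm_le hx hx1 (j + 2)
    rw [show j + 1 + 2 = (j + 2) + 1 by ring, Nat.factorial_succ]
    push_cast at h ⊢
    calc ((j : ℝ) + 2 + 1) * (j + 2).factorial * elemSymm x Finset.univ (j + 2 + 1)
        = (j + 2).factorial * (((j : ℝ) + 2 + 1) * elemSymm x Finset.univ (j + 2 + 1)) := by ring
      _ ≤ _ := mul_le_mul_of_nonneg_left h (Nat.cast_nonneg _)

theorem abs_deletedSymm_le {x : ι → ℝ} (hx : ∀ i, 0 ≤ x i) (hx1 : ∑ i, x i = 1) (j : ℕ) {z : ℝ}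
    (hz : 0 ≤ z) (hz1 : z ≤ 1) : |deletedSymm x j z| ≤ j + 1 := by
  induction j with
  | zero => simp [deletedSymm]
  | succ j ih =>
    rw [deletedSymm]
    have h1 := elemSymm_le_one hx hx1 (j + 1)
    have h0 := elemSymm_nonneg hx Finset.univ (j + 1)
    have h2 : |z * deletedSymm x j z| ≤ j + 1 := by
      rw [abs_mul, abs_of_nonneg hz]
      exact (mul_le_of_le_one_left (abs_nonneg _) hz1).trans ih
    push_cast
    refine (abs_sub _ _).trans ?_
    rw [abs_of_nonneg h0]
    linarith

/-- This Lipschitz bound allows the value at `x i` to be replaced by the value at `1 / t`. -/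
theorem abs_deletedSymm_sub_le {x : ι → ℝ} (hx : ∀ i, 0 ≤ x i) (hx1 : ∑ i, x i = 1) (j : ℕ)
    {z w : ℝ} (hz : 0 ≤ z) (hz1 : z ≤ 1) (hw : 0 ≤ w) (hw1 : w ≤ 1) :
    |deletedSymm x j z - deletedSymm x j w| ≤ ((j : ℝ) + 1) ^ 2 * |z - w| := by
  induction j with
  | zero => simp [deletedSymm]
  | succ j ih =>
    rw [deletedSymm, deletedSymm,
      show elemSymm x Finset.univ (j + 1) - z * deletedSymm x j z -
        (elemSymm x Finset.univ (j + 1) - w * deletedSymm x j w) =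
        -(z * (deletedSymm x j z - deletedSymm x j w) + deletedSymm x j w * (z - w)) by ring,
      abs_neg]
    refine (abs_add_le _ _).trans ?_
    rw [abs_mul, abs_mul, abs_of_nonneg hz]
    have h1 := (mul_le_of_le_one_left (abs_nonneg _) hz1).trans ih
    have h2 := mul_le_mul_of_nonneg_right (abs_deletedSymm_le hx hx1 j hw hw1) (abs_nonneg (z - w))
    have h3 := mul_nonneg (Nat.cast_nonneg (α := ℝ) j) (abs_nonneg (z - w))
    have h4 := abs_nonneg (z - w)
    push_cast
    nlinarith

/-- With small weights, repeated indices cost at most half of the total in each step of the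
recursion, so each degree loses at most a factor `2 * (j + 1)`. -/
theorem elemSymm_lower_bound {x : ι → ℝ} (hx : ∀ i, 0 ≤ x i) (hx1 : ∑ i, x i = 1) {r : ℕ} {δ : ℝ}
    (hδ : ∀ i, x i ≤ δ) (hrδ : 2 * r * δ ≤ 1) {j : ℕ} (hj : j ≤ r) :
    1 ≤ 2 ^ j * (j.factorial : ℝ) * elemSymm x Finset.univ j := by
  have hδ0 : 0 ≤ δ := by
    by_contra! h
    have : ∑ i, x i ≤ 0 := Finset.sum_nonpos fun i _ => (hδ i).trans h.le
    linarith
  have key : ∀ j, j + 1 ≤ r → elemSymm x Finset.univ j ≤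
      2 * (((j : ℝ) + 1) * elemSymm x Finset.univ (j + 1)) := by
    rintro (_ | j) hj
    · have h := sum_mul_deletedSymm x 0
      simp [deletedSymm, hx1, elemSymm_zero] at h ⊢
      linarith
    · have h := succ_succ_mul_elemSymm hx1 j
      have h1 : ∑ i, x i ^ 2 * deletedSymm x j (x i) ≤
          δ * ((j + 1) * elemSymm x Finset.univ (j + 1)) := by
        rw [← sum_mul_deletedSymm, Finset.mul_sum]
        refine Finset.sum_le_sum fun i _ => ?_
        have := mul_le_mul_of_nonneg_right (hδ i)
          (mul_nonneg (hx i) (deletedSymm_apply_nonneg hx j i))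
        linarith
      have h2 : δ * ((j : ℝ) + 1) ≤ 1 / 2 := by
        have : ((j : ℝ) + 1) ≤ r := by exact_mod_cast (by omega : j + 1 ≤ r)
        nlinarith
      have h3 := mul_le_mul_of_nonneg_right h2 (elemSymm_nonneg hx Finset.univ (j + 1))
      push_cast
      rw [show (j : ℝ) + 1 + 1 = j + 2 by ring, show j + 1 + 1 = j + 2 by ring]
      linarith
  induction j with
  | zero => simp [elemSymm_zero]
  | succ j ih =>
    refine (ih (by omega)).trans ?_
    have := mul_le_mul_of_nonneg_left (key j hj)
      (by positivity : (0 : ℝ) ≤ 2 ^ j * (j.factorial : ℝ))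
    rw [Nat.factorial_succ, pow_succ]
    push_cast
    linarith

end ElemSymm

/-! ### Comparison with the uniform distribution under an entropy bound -/

/-- With `w = v ^ 2` and `log w ≤ 2 * (v - 1)`, replacing `a` by `b` leaves a gain of `b * (v - 1) ^
2`. It absorbs the error `κ * (w - 1) ^ 2`, because `(v + 1) ^ 2 ≤ 2 + 2 * w`. -/
theorem mul_log_le_of_abs_sub_le {a b κ w : ℝ} (hw : 0 < w) (hb : 0 ≤ b)
    (hab : |a - b| ≤ κ * |w - 1|) (hκ0 : 0 ≤ κ) (hκ : κ * (2 + 2 * w) ≤ b) :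
    b * Real.log w ≤ a * (w - 1) := by
  obtain ⟨v, hv, rfl⟩ : ∃ v : ℝ, 0 < v ∧ w = v ^ 2 :=
    ⟨√w, Real.sqrt_pos.2 hw, (Real.sq_sqrt hw.le).symm⟩
  have hlog : Real.log (v ^ 2) ≤ 2 * (v - 1) := by
    rw [Real.log_pow]
    have := Real.log_le_sub_one_of_pos hv
    push_cast
    linarith
  have h1 : b * Real.log (v ^ 2) ≤ b * (2 * (v - 1)) := mul_le_mul_of_nonneg_left hlog hb
  have h2 : -((a - b) * (v ^ 2 - 1)) ≤ κ * (v ^ 2 - 1) ^ 2 := by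
    refine (neg_le_abs _).trans ?_
    rw [abs_mul, ← sq_abs (v ^ 2 - 1), sq |v ^ 2 - 1|, ← mul_assoc]
    exact mul_le_mul_of_nonneg_right hab (abs_nonneg _)
  have h3 : κ * (v + 1) ^ 2 ≤ b := by
    nlinarith [mul_nonneg hκ0 (sq_nonneg (v - 1))]
  have h4 := mul_le_mul_of_nonneg_right h3 (sq_nonneg (v - 1))
  nlinarith

/-- As `1 / t` need not be one of the weights, positivity is not automatic: the leading term is at
least `2 / D` and the correction at most `r / t ≤ 1 / D`. -/
theorem deletedSymm_inv_lower_bound {ι : Type*} [Fintype ι] {x : ι → ℝ} (hx : ∀ i, 0 ≤ x i)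
    (hx1 : ∑ i, x i = 1) {r : ℕ} {D t : ℝ} (hD : D = 2 ^ (r + 1) * (r.factorial : ℝ))
    (ht : r * D ≤ t) (ht1 : 1 ≤ t) {j : ℕ} (hj : j ≤ r)
    (hE : 1 ≤ 2 ^ j * (j.factorial : ℝ) * elemSymm x Finset.univ j) :
    1 / D ≤ deletedSymm x j (1 / t) := by
  have hD0 : 0 < D := by rw [hD]; positivity
  have hE' : 2 / D ≤ elemSymm x Finset.univ j := by
    rw [div_le_iff₀ hD0]
    have h1 : (2 : ℝ) ^ j * (j.factorial : ℝ) ≤ 2 ^ r * (r.factorial : ℝ) := by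
      gcongr
      norm_num
    have h2 := mul_le_mul_of_nonneg_right h1 (elemSymm_nonneg hx Finset.univ j)
    rw [hD, pow_succ]
    linarith
  cases j with
  | zero =>
    rw [deletedSymm]
    rw [elemSymm_zero] at hE'
    have : (2 : ℝ) / D = 2 * (1 / D) := by ring
    have : 0 < 1 / D := by positivity
    linarith
  | succ j =>
    rw [deletedSymm]
    have ht0 : 0 < t := by linarith
    have h1 := (le_abs_self _).trans (abs_deletedSymm_le hx hx1 j
      (by positivity : (0 : ℝ) ≤ 1 / t) ((div_le_one ht0).2 ht1))
    have h2 : 1 / t * deletedSymm x j (1 / t) ≤ 1 / D := by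
      rw [one_div_mul_eq_div, div_le_div_iff₀ ht0 hD0]
      have : ((j : ℝ) + 1) ≤ r := by exact_mod_cast hj
      have := mul_le_mul_of_nonneg_right (h1.trans this) hD0.le
      linarith
    have : (2 : ℝ) / D = 1 / D + 1 / D := by ring
    linarith

/-- The previous logarithmic inequality is applied with `w = t * x i`, weighted by `x i` and summed;
the logarithms add up to the nonnegative entropy term. -/
theorem sum_mul_deletedSymm_le {ι : Type*} [Fintype ι] {x : ι → ℝ} (hx : ∀ i, 0 ≤ x i)
    (hx1 : ∑ i, x i = 1) {t c δ : ℝ} (ht : 1 ≤ t) (hent : 0 ≤ ∑ i, x i * Real.log (t * x i))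
    (hδ : ∀ i, x i ≤ δ) {j : ℕ} (hc : 0 ≤ c) (hcG : c ≤ deletedSymm x j (1 / t))
    (hsmall : ((j : ℝ) + 1) ^ 2 * (2 / t + 2 * δ) ≤ c) :
    ∑ i, x i * deletedSymm x j (x i) ≤ t * ∑ i, x i ^ 2 * deletedSymm x j (x i) := by
  have ht0 : 0 < t := by linarith
  have hle : ∀ i, x i ≤ 1 := fun i => hx1 ▸ Finset.single_le_sum (fun k _ => hx k) (Finset.mem_univ i)
  set b := deletedSymm x j (1 / t)
  have key : ∀ i, b * (x i * Real.log (t * x i)) ≤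
      t * (x i ^ 2 * deletedSymm x j (x i)) - x i * deletedSymm x j (x i) := by
    intro i
    rcases (hx i).eq_or_lt with h0 | h0
    · simp [← h0]
    have h := mul_log_le_of_abs_sub_le (a := deletedSymm x j (x i)) (b := b)
      (κ := ((j : ℝ) + 1) ^ 2 / t) (w := t * x i) (by positivity) (hc.trans hcG) ?_ (by positivity) ?_
    · have := mul_le_mul_of_nonneg_left h h0.le
      linarith
    · refine (abs_deletedSymm_sub_le hx hx1 j (hx i) (hle i) (by positivity)
        ((div_le_one ht0).2 ht)).trans (le_of_eq ?_)
      rw [show x i - 1 / t = (t * x i - 1) / t by field_simp, abs_div, abs_of_pos ht0]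
      ring
    · refine le_trans ?_ (hsmall.trans hcG)
      rw [div_mul_eq_mul_div, mul_div_assoc]
      refine mul_le_mul_of_nonneg_left ?_ (by positivity)
      rw [show (2 + 2 * (t * x i)) / t = 2 / t + 2 * x i by field_simp]
      linarith [hδ i]
  have h := Finset.sum_le_sum fun i (_ : i ∈ Finset.univ) => key i
  rw [← Finset.mul_sum, Finset.sum_sub_distrib, ← Finset.mul_sum] at h
  have := mul_nonneg (hc.trans hcG) hent
  linarith

theorem succ_mul_choose_div_pow {t : ℕ} (ht : 0 < t) {j : ℕ} (hj : j ≤ t) :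
    ((j : ℝ) + 1) * ((t.choose (j + 1) : ℝ) / (t : ℝ) ^ (j + 1)) =
      (1 - j / t) * ((t.choose j : ℝ) / (t : ℝ) ^ j) := by
  have h := congrArg (Nat.cast (R := ℝ)) (Nat.choose_succ_right_eq t j)
  push_cast [Nat.cast_sub hj] at h
  have ht0 : (t : ℝ) ≠ 0 := by positivity
  rw [pow_succ]
  field_simp
  linarith

theorem one_sub_sq_div_le_choose_div_pow {t : ℕ} (ht : 0 < t) {j : ℕ} (hj : j ≤ t) :
    1 - (j : ℝ) ^ 2 / t ≤ (j.factorial : ℝ) * ((t.choose j : ℝ) / (t : ℝ) ^ j) := by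
  have ht0 : (0 : ℝ) < t := by positivity
  induction j with
  | zero => simp
  | succ j ih =>
    have h := succ_mul_choose_div_pow ht (by omega : j ≤ t)
    have hjt : (j : ℝ) / t ≤ 1 := (div_le_one ht0).2 (by exact_mod_cast (by omega : j ≤ t))
    have h1 := mul_le_mul_of_nonneg_left (ih (by omega)) (sub_nonneg.2 hjt)
    have h2 : ((j + 1).factorial : ℝ) * ((t.choose (j + 1) : ℝ) / (t : ℝ) ^ (j + 1)) =
        (1 - j / t) * ((j.factorial : ℝ) * ((t.choose j : ℝ) / (t : ℝ) ^ j)) := by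
      rw [Nat.factorial_succ]
      push_cast
      linear_combination (j.factorial : ℝ) * h
    rw [h2]
    refine le_trans ?_ h1
    have h3 : 0 ≤ (j : ℝ) / t * ((j : ℝ) ^ 2 / t) := by positivity
    have h4 : 0 ≤ ((j : ℝ) + 1) / t := by positivity
    push_cast
    have h5 : ((j : ℝ) + 1) ^ 2 / t = (j : ℝ) ^ 2 / t + j / t + (j + 1) / t := by ring
    rw [h5]
    linarith

/-- A probability vector of entropy at most `log t` has elementary symmetric polynomials at most
those of the uniform distribution on `t` points, provided that `t` is large. -/
theorem elemSymm_le_choose_div_pow {ι : Type*} [Fintype ι] {x : ι → ℝ} (hx : ∀ i, 0 ≤ x i)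
    (hx1 : ∑ i, x i = 1) {r t : ℕ} (hr : 2 ≤ r)
    (ht : (8 * r ^ 3 * (2 ^ (r + 1) * r.factorial)) ^ 2 ≤ t)
    (hent : 0 ≤ ∑ i, x i * Real.log (t * x i)) :
    elemSymm x Finset.univ r ≤ (t.choose r : ℝ) / (t : ℝ) ^ r := by
  obtain ⟨D, hD⟩ : ∃ D : ℝ, D = 2 ^ (r + 1) * (r.factorial : ℝ) := ⟨_, rfl⟩
  have hr1 : (2 : ℝ) ≤ r := by exact_mod_cast hr
  have hD1 : 1 ≤ D := by
    rw [hD]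
    exact one_le_mul_of_one_le_of_one_le (one_le_pow₀ (by norm_num))
      (by exact_mod_cast Nat.factorial_pos r)
  have htR : (8 * (r : ℝ) ^ 3 * D) ^ 2 ≤ t := by rw [hD]; exact_mod_cast ht
  have hr2 : (r : ℝ) ≤ (r : ℝ) ^ 3 := le_self_pow₀ (by linarith) (by norm_num)
  have hB : (r : ℝ) ≤ (r : ℝ) ^ 3 * D := by nlinarith
  have hrD : (r : ℝ) * D ≤ (r : ℝ) ^ 3 * D := by gcongr
  have hst : 8 * (r : ℝ) ^ 3 * D ≤ √(t : ℝ) := Real.le_sqrt_of_sq_le htR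
  have hs1 : 1 ≤ √(t : ℝ) := by linarith
  have hss : √(t : ℝ) ^ 2 = t := Real.sq_sqrt (Nat.cast_nonneg t)
  have hstt : √(t : ℝ) ≤ t := by nlinarith
  have ht0 : (0 : ℝ) < t := by linarith
  have htN : 0 < t := by exact_mod_cast ht0
  have hrt : r ≤ t := by
    have : (r : ℝ) ≤ t := by linarith
    exact_mod_cast this
  -- At this threshold the bound `1 - ∑ x i ^ 2` already falls below the uniform value; under it,
  -- every weight is at most `r / √t`.
  by_cases hp : (r : ℝ) ^ 2 / t ≤ ∑ i, x i ^ 2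
  · obtain ⟨k, rfl⟩ := Nat.exists_eq_add_of_le' hr
    have h1 := factorial_mul_elemSymm_le hx hx1 k
    have h2 := one_sub_sq_div_le_choose_div_pow htN hrt
    exact le_of_mul_le_mul_left (h1.trans (le_trans (by linarith) h2))
      (by exact_mod_cast Nat.factorial_pos _)
  push Not at hp
  have hδ : ∀ i, x i ≤ r / √(t : ℝ) := by
    intro i
    refine abs_le_of_sq_le_sq' ?_ (by positivity) |>.2
    rw [div_pow, hss]
    exact (Finset.single_le_sum (f := fun k => x k ^ 2) (fun k _ => sq_nonneg (x k))
      (Finset.mem_univ i)).trans hp.le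
  have hrδ : 2 * r * (r / √(t : ℝ)) ≤ 1 := by
    rw [← mul_div_assoc, div_le_one (by linarith)]
    have : (r : ℝ) * r ≤ (r : ℝ) ^ 3 := by nlinarith
    nlinarith
  have hstep : ∀ j, j + 2 ≤ r → ((j : ℝ) + 2) * elemSymm x Finset.univ (j + 2) ≤
      (1 - (j + 1) / t) * elemSymm x Finset.univ (j + 1) := by
    intro j hj
    have hG := deletedSymm_inv_lower_bound hx hx1 hD (by linarith : (r : ℝ) * D ≤ t) (by linarith)
      (by omega : j ≤ r) (elemSymm_lower_bound hx hx1 hδ hrδ (by omega : j ≤ r))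
    have h := sum_mul_deletedSymm_le hx hx1 (by linarith) hent hδ (by positivity) hG ?_
    · rw [sum_mul_deletedSymm] at h
      rw [succ_succ_mul_elemSymm hx1, sub_mul, one_mul, div_mul_eq_mul_div]
      refine sub_le_sub_left ((div_le_iff₀ ht0).2 ?_) _
      linarith
    · have hjr : ((j : ℝ) + 1) ^ 2 ≤ (r : ℝ) ^ 2 := by
        have : ((j : ℝ) + 1) ≤ r := by exact_mod_cast (by omega : j + 1 ≤ r)
        gcongr
      have h1 : 2 / (t : ℝ) + 2 * (r / √(t : ℝ)) ≤ 4 * r / √(t : ℝ) := by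
        have : 2 / (t : ℝ) ≤ 2 * r / √(t : ℝ) := by
          rw [div_le_div_iff₀ ht0 (by linarith)]
          nlinarith
        have h' : 4 * r / √(t : ℝ) = 2 * r / √(t : ℝ) + 2 * (r / √(t : ℝ)) := by ring
        linarith
      calc ((j : ℝ) + 1) ^ 2 * (2 / t + 2 * (r / √(t : ℝ)))
          ≤ (r : ℝ) ^ 2 * (4 * r / √(t : ℝ)) := by gcongr
        _ ≤ 1 / D := by
          rw [← mul_div_assoc, div_le_div_iff₀ (by linarith) (by linarith)]
          have : 0 ≤ (r : ℝ) ^ 3 * D := by positivity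
          linarith
  have hind : ∀ j, j + 1 ≤ r → elemSymm x Finset.univ (j + 1) ≤
      (t.choose (j + 1) : ℝ) / (t : ℝ) ^ (j + 1) := by
    intro j
    induction j with
    | zero =>
      intro _
      have h := sum_mul_deletedSymm x 0
      simp [deletedSymm, hx1] at h
      simp [← h, div_self ht0.ne']
    | succ j ih =>
      intro hj
      have h1 := hstep j hj
      have h2 := succ_mul_choose_div_pow htN (by omega : j + 1 ≤ t)
      have h3 : ((j : ℝ) + 1) / t ≤ 1 := (div_le_one ht0).2 (by exact_mod_cast (by omega : j + 1 ≤ t))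
      have h4 := mul_le_mul_of_nonneg_left (ih (by omega)) (sub_nonneg.2 h3)
      push_cast at h2
      rw [show (j : ℝ) + 1 + 1 = j + 2 by ring] at h2
      exact le_of_mul_le_mul_left ((h1.trans h4).trans h2.ge) (by positivity)
  obtain ⟨k, rfl⟩ := Nat.exists_eq_add_of_le' (by omega : 1 ≤ r)
  exact hind k le_rfl

/-! ### Stationarity and the entropy bound at a maximum point -/

section Lagrangian

variable {V : Type*} [Fintype V]

/-- The stationarity conditions at a maximum point of a hypergraph polynomial on the simplex. -/
theorem sum_filter_mem_prod_eq_of_isMax [DecidableEq V] {H : Finset (Finset V)} {r : ℕ}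
    (hH : ∀ A ∈ H, A.card = r) {y : V → ℝ} (hy : y ∈ stdSimplex ℝ V)
    (hmax : ∀ z ∈ stdSimplex ℝ V, hypergraphPoly H z ≤ hypergraphPoly H y) (i : V) :
    ∑ A ∈ H with i ∈ A, ∏ k ∈ A, y k = r * hypergraphPoly H y * y i := by
  set P := hypergraphPoly H y with hP
  set S := ∑ A ∈ H with i ∈ A, ∏ k ∈ A, y k with hS
  -- Scaling `y i` by `1 + ε` and renormalising stays in the simplex for both signs of `ε`, so `g`
  -- has a local minimum at `0`, even if `y i = 0`.
  set g : ℝ → ℝ := fun ε => P * (1 + ε * y i) ^ r - (P + ε * S) with hg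
  have hyi1 : y i ≤ 1 := hy.2 ▸ Finset.single_le_sum (fun k _ => hy.1 k) (Finset.mem_univ i)
  have hpoly : ∀ ε, hypergraphPoly H (Function.update y i ((1 + ε) * y i)) = P + ε * S := by
    intro ε
    rw [hP, hS, hypergraphPoly, hypergraphPoly, Finset.mul_sum, Finset.sum_filter,
      ← Finset.sum_add_distrib]
    refine Finset.sum_congr rfl fun A _ => ?_
    split_ifs with hiA
    · rw [Finset.prod_update_of_mem hiA, ← Finset.mul_prod_erase A y hiA, Finset.sdiff_singleton_eq_erase]
      ring
    · rw [Finset.prod_update_of_notMem hiA, add_zero]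
  have hnonneg : ∀ ε, -1 < ε → 0 ≤ g ε := by
    intro ε hε
    have hpos : 0 < 1 + ε * y i := by
      rcases (hy.1 i).eq_or_lt with h0 | h0
      · simp [← h0]
      · nlinarith
    have hmem : (fun k => (1 + ε * y i)⁻¹ * Function.update y i ((1 + ε) * y i) k) ∈
        stdSimplex ℝ V := by
      refine ⟨fun k => mul_nonneg (inv_nonneg.2 hpos.le) ?_, ?_⟩
      · rcases eq_or_ne k i with rfl | hk
        · rw [Function.update_self]
          exact mul_nonneg (by linarith) (hy.1 k)
        · rw [Function.update_of_ne hk]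
          exact hy.1 k
      · rw [← Finset.mul_sum, Finset.sum_update_of_mem (Finset.mem_univ i)]
        have h := Finset.add_sum_erase Finset.univ y (Finset.mem_univ i)
        rw [hy.2] at h
        rw [Finset.sdiff_singleton_eq_erase, inv_mul_eq_one₀ hpos.ne']
        linarith
    have h := hmax _ hmem
    have hscale : hypergraphPoly H
        (fun k => (1 + ε * y i)⁻¹ * Function.update y i ((1 + ε) * y i) k) =
        (1 + ε * y i)⁻¹ ^ r * (P + ε * S) := by
      rw [← hpoly, hypergraphPoly, hypergraphPoly, Finset.mul_sum]
      refine Finset.sum_congr rfl fun A hA => ?_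
      rw [Finset.prod_mul_distrib, Finset.prod_const, hH A hA]
    rw [hscale, inv_pow, inv_mul_le_iff₀ (by positivity)] at h
    simp only [hg]
    linarith
  have hmin : IsLocalMin g 0 := by
    filter_upwards [Ioi_mem_nhds (show (-1 : ℝ) < 0 by norm_num)] with ε hε
    simpa [hg] using hnonneg ε hε
  have hder : HasDerivAt g (P * (r * (1 + 0 * y i) ^ (r - 1) * (1 * y i)) - (1 * S)) 0 := by
    refine HasDerivAt.sub (HasDerivAt.const_mul P ?_) ?_
    · exact (((hasDerivAt_id (0 : ℝ)).mul_const (y i)).const_add 1).pow r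
    · exact ((hasDerivAt_id (0 : ℝ)).mul_const S).const_add P
  have h := hmin.hasDerivAt_eq_zero hder
  simp at h
  linarith

theorem hypergraphPoly_le_elemSymm {H : Finset (Finset V)} {r : ℕ} (hH : ∀ A ∈ H, A.card = r)
    {y : V → ℝ} (hy : ∀ i, 0 ≤ y i) : hypergraphPoly H y ≤ elemSymm y Finset.univ r :=
  Finset.sum_le_sum_of_subset_of_nonneg
    (fun A hA => Finset.mem_powersetCard.2 ⟨Finset.subset_univ A, hH A hA⟩)
    fun _ _ _ => Finset.prod_nonneg fun i _ => hy i

theorem sub_le_mul_log_sub_log {a b : ℝ} (ha : 0 ≤ a) (hb : 0 < b) : a - b ≤ a * (Real.log a - Real.log b) := by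
  rcases ha.eq_or_lt with rfl | ha
  · simpa using hb.le
  have h := Real.log_le_sub_one_of_pos (div_pos hb ha)
  rw [Real.log_div hb.ne' ha.ne'] at h
  have := mul_le_mul_of_nonneg_left h ha.le
  rw [mul_sub a (b / a), mul_div_cancel₀ b ha.ne'] at this
  linarith

/-- The entropy bound for the Lagrangian: `λ ≤ m exp (-r h(y))` at a maximum point `y`. -/
theorem log_div_card_le_of_isMax {H : Finset (Finset V)} {r : ℕ}
    (hH : ∀ A ∈ H, A.card = r) {y : V → ℝ} (hy : y ∈ stdSimplex ℝ V)
    (hmax : ∀ z ∈ stdSimplex ℝ V, hypergraphPoly H z ≤ hypergraphPoly H y)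
    (hpos : 0 < hypergraphPoly H y) :
    Real.log (hypergraphPoly H y / H.card) ≤ r * ∑ i, y i * Real.log (y i) := by
  classical
  have hcard : (0 : ℝ) < H.card := by
    rw [Nat.cast_pos, Finset.card_pos]
    by_contra! h
    simp [h, hypergraphPoly] at hpos
  set P := hypergraphPoly H y with hP
  -- Gibbs' inequality against the uniform weight `P / H.card`: the differences sum to zero.
  have h1 := Finset.sum_le_sum fun A (_ : A ∈ H) =>
    sub_le_mul_log_sub_log (Finset.prod_nonneg fun i (_ : i ∈ A) => hy.1 i) (div_pos hpos hcard)
  have h2 : ∑ A ∈ H, (∏ i ∈ A, y i) * Real.log (∏ i ∈ A, y i) =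
      P * (r * ∑ i, y i * Real.log (y i)) := by
    calc ∑ A ∈ H, (∏ i ∈ A, y i) * Real.log (∏ i ∈ A, y i)
        = ∑ A ∈ H, ∑ i ∈ A, (∏ k ∈ A, y k) * Real.log (y i) := by
          refine Finset.sum_congr rfl fun A _ => ?_
          rw [← Finset.mul_sum]
          by_cases h0 : ∃ i ∈ A, y i = 0
          · obtain ⟨i, hi, h0⟩ := h0
            simp [Finset.prod_eq_zero hi h0]
          · push Not at h0
            rw [Real.log_prod h0]
      _ = ∑ i, (∑ A ∈ H with i ∈ A, ∏ k ∈ A, y k) * Real.log (y i) := by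
          simp_rw [Finset.sum_mul, Finset.sum_filter]
          rw [Finset.sum_comm]
          refine Finset.sum_congr rfl fun A _ => ?_
          rw [← Finset.sum_filter, Finset.filter_mem_eq_inter, Finset.univ_inter]
      _ = P * (r * ∑ i, y i * Real.log (y i)) := by
          rw [Finset.mul_sum, Finset.mul_sum]
          refine Finset.sum_congr rfl fun i _ => ?_
          rw [sum_filter_mem_prod_eq_of_isMax hH hy hmax i]
          ring
  simp only [mul_sub, Finset.sum_sub_distrib, h2, ← Finset.sum_mul, Finset.sum_const,
    nsmul_eq_mul] at h1
  rw [mul_div_cancel₀ P hcard.ne', show ∑ A ∈ H, ∏ i ∈ A, y i = P from rfl, sub_self] at h1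
  exact le_of_mul_le_mul_left (by linarith) hpos

end Lagrangian

theorem corollary1p4 (r : ℕ) (hr : 4 ≤ r) :
    ∃ t_r : ℕ, ∀ t : ℕ, t_r ≤ t →
      ∀ m : ℕ, (t - 1).choose r < m → m ≤ t.choose r →
        ∀ (V : Type*) [Fintype V] (H : Finset (Finset V)),
          (H : Set (Finset V)).Sized r → H.card = m →
            lagrangian H ≤ (t.choose r : ℝ) / (t : ℝ) ^ r := by
  -- With `D = 2 ^ (r + 1) * r!`, this gives `√t ≥ 8 * r ^ 3 * D`, so the Lipschitz error `4 * r ^ 3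
  -- / √t` is below `1 / D`.
  refine ⟨(8 * r ^ 3 * (2 ^ (r + 1) * r.factorial)) ^ 2, ?_⟩
  intro t ht m hm1 hm V _ H hsized hcard
  have hH : ∀ A ∈ H, A.card = r := fun A hA => hsized hA
  have ht0 : (0 : ℝ) < t := by
    have : 0 < (8 * r ^ 3 * (2 ^ (r + 1) * r.factorial)) ^ 2 := by positivity
    exact_mod_cast this.trans_le ht
  obtain ⟨A, hA⟩ := Finset.card_pos.1 (by omega : 0 < H.card)
  obtain ⟨v, -⟩ := Finset.card_pos.1 (by rw [hH A hA]; omega : 0 < A.card)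
  have : Nonempty V := ⟨v⟩
  obtain ⟨⟨y, hy, hyl⟩, hub⟩ := isGreatest_lagrangian H
  have hmax : ∀ z ∈ stdSimplex ℝ V, hypergraphPoly H z ≤ hypergraphPoly H y := fun z hz =>
    hyl ▸ hub ⟨z, hz, rfl⟩
  rw [← hyl]
  rcases le_or_gt (hypergraphPoly H y) 0 with hP | hP
  · exact hP.trans (by positivity)
  have hlog : ∑ i, y i * Real.log (t * y i) = Real.log t + ∑ i, y i * Real.log (y i) := by
    rw [← one_mul (Real.log t), ← hy.2, Finset.sum_mul, ← Finset.sum_add_distrib]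
    refine Finset.sum_congr rfl fun i _ => ?_
    rcases eq_or_ne (y i) 0 with h0 | h0
    · simp [h0]
    · rw [Real.log_mul ht0.ne' h0]
      ring
  rcases le_total 0 (∑ i, y i * Real.log (t * y i)) with hent | hent
  · exact (hypergraphPoly_le_elemSymm hH hy.1).trans
      (elemSymm_le_choose_div_pow hy.1 hy.2 (by omega) ht hent)
  · have hc0 : (0 : ℝ) < H.card := by exact_mod_cast (by omega : 0 < H.card)
    have h1 : Real.log (hypergraphPoly H y / H.card) ≤ Real.log (((t : ℝ) ^ r)⁻¹) := by
      refine (log_div_card_le_of_isMax hH hy hmax hP).trans ?_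
      rw [Real.log_inv, Real.log_pow, ← mul_neg]
      exact mul_le_mul_of_nonneg_left (by linarith) (Nat.cast_nonneg r)
    have h2 := (Real.log_le_log_iff (div_pos hP hc0) (by positivity)).1 h1
    rw [div_le_iff₀ hc0, inv_mul_eq_div] at h2
    refine h2.trans ?_
    gcongr
    omega
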